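/- **Theorem 3.2 (Kleene–Schützenberger Theorem for Stochastic Languages).** Let $\Sigma$ be a finite alphabet. A *stochastic language* is a function $f:\Sigma^*\to\mathbb{R}$ with $f(w)\ge 0$ for all $w$ and $\sum_{w\in\Sigma^*}f(w)=1$ (so its values lie in $[0,1]$). For a word $u$ let $\delta_u$ be the function with $\delta_u(u)=1$ and $\delta_u(w)=0$ for $w\ne u$; let $\varepsilon$ be the empty word. A *probabilistic automaton* consists of a finite state set $Q$ and weights $\lambda,\mu\in\mathbb{R}_{\ge0}^{Q}$, $M_a\in\mathbb{R}_{\ge0}^{Q\times Q}$ ($a\in\Sigma$) with $\sum_{q}\lambda(q)=1$ and $\mu(q)+\sum_{a\in\Sigma}\sum_{q'\in Q}M_a(q,q')=1$ for every $q\in Q$. It computes the function $w_1\cdots w_n\mapsto\lambda^{\top}M_{w_1}\cdots M_{w_n}\mu$. *Stochastic regular expressions* (SREs) are given by the grammar $r::=\delta_a\mid\alpha r_1+(1-\alpha)r_2\mid r_1\cdot r_2\mid r^*_\alpha$ with $a\in\Sigma$, $\alpha\in(0,1)$. Their semantics $\llbracket r\rrbracket:\Sigma^*\to\mathbb{R}$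 is: $\llbracket\delta_a\rrbracket$ is the Dirac function at the one-letter word $a$; $\llbracket\alpha r_1+(1-\alpha)r_2\rrbracket=\alpha\llbracket r_1\rrbracket+(1-\alpha)\llbracket r_2\rrbracket$; $\llbracket r_1\cdot r_2\rrbracket(w)=\sum_{w=uv}\llbracket r_1\rrbracket(u)\llbracket r_2\rrbracket(v)$; and $$\llbracket r^*_\alpha\rrbracket(w)=\sum_{k\ge1}\ \sum_{\substack{w=w_1\cdots w_k\\ w_i\neq\varepsilon}}\alpha(1-\alpha)^{k-1}\prod_{i=1}^k\llbracket r\rrbracket(w_i).$$ For every function $f:\Sigma^*\to\mathbb{R}$: 1. $f=\llbracket r\rrbracket$ for some SRE $r$ if and only if $f$ is a stochastic language with $f(\varepsilon)=0$ that is computed by a probabilistic automaton. 2. $f$ is a stochastic language computed by a probabilistic automaton if and only if $f=\delta_\varepsilon$ or $f=c\,\delta_\varepsilon+(1-c)\llbracket r\rrbracket$ for some $c\in[0,1)$ and some SRE $r$. -/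

import Mathlib

open scoped NNReal Matrix

/-- A quantitative language `f` (a real-valued function on words) is a *stochastic language* if it
is nonnegative and its total mass is `1`. -/
def IsStochasticLanguage {σ : Type*} (f : List σ → ℝ) : Prop :=
  (∀ w, 0 ≤ f w) ∧ HasSum f 1

/-- The Dirac distribution concentrated at the word `u`. -/
noncomputable def diracLang {σ : Type*} (u : List σ) (w : List σ) : ℝ :=
  open Classical in if w = u then 1 else 0

/-- A weighted automaton over the semiring `K` with alphabet `σ` and state set `Q`:
initial weights, one transition matrix for each letter, and final weights. -/
structure WeightedAutomaton (K σ Q : Type*) where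
  init : Q → K
  trans : σ → Matrix Q Q K
  final : Q → K

namespace WeightedAutomaton

/-- `A.value w q` is the entry at `q` of the vector `M_{w₁} (M_{w₂} (⋯ (M_{wₙ} μ)))`. -/
def value {K σ Q : Type*} [Semiring K] [Fintype Q] (A : WeightedAutomaton K σ Q) :
    List σ → Q → K
  | [] => A.final
  | a :: w => A.trans a *ᵥ A.value w

/-- The semantics of a weighted automaton: `w ↦ λᵀ M_{w₁} ⋯ M_{wₙ} μ`. -/
def semantics {K σ Q : Type*} [Semiring K] [Fintype Q] (A : WeightedAutomaton K σ Q)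
    (w : List σ) : K :=
  A.init ⬝ᵥ A.value w

/-- A weighted automaton over `ℝ≥0` is a (generative) *probabilistic automaton* if its initial
vector is a probability distribution and it is locally stochastic. -/
def IsProbabilistic {σ Q : Type*} [Fintype σ] [Fintype Q] (A : WeightedAutomaton ℝ≥0 σ Q) : Prop :=
  ∑ q, A.init q = 1 ∧ ∀ q, A.final q + ∑ a, ∑ q', A.trans a q q' = 1

end WeightedAutomaton

/-- `f` is computed by some probabilistic automaton (with a finite set of states). -/
def ComputedByProbAutomaton {σ : Type*} [Fintype σ] (f : List σ → ℝ) : Prop :=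
  ∃ (Q : Type) (_ : Fintype Q) (A : WeightedAutomaton ℝ≥0 σ Q),
    A.IsProbabilistic ∧ ∀ w, f w = (A.semantics w : ℝ)

/-- The Cauchy product `(f · g)(w) = ∑_{w = uv} f(u) g(v)`; the splittings of `w` are given by
the length of the prefix. -/
def cauchyProd {σ : Type*} (f g : List σ → ℝ) (w : List σ) : ℝ :=
  ∑ i ∈ Finset.range (w.length + 1), f (w.take i) * g (w.drop i)

/-- The factorizations `w = w₁ ⋯ wₖ` of `w` into `k` nonempty words. -/
def factorizations {σ : Type*} (k : ℕ) (w : List σ) : Set (List (List σ)) :=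
  {L | L.length = k ∧ (∀ u ∈ L, u ≠ []) ∧ L.flatten = w}

/-- The geometric star
`f*_α(w) = ∑_{k ≥ 1} ∑_{w = w₁ ⋯ wₖ, wᵢ ≠ ε} α (1 - α)^(k - 1) ∏ᵢ f(wᵢ)`;
the index `k` of the outer sum below is shifted by one. -/
noncomputable def geomStar {σ : Type*} (α : ℝ) (f : List σ → ℝ) (w : List σ) : ℝ :=
  ∑' k : ℕ, ∑ᶠ L ∈ factorizations (k + 1) w, α * (1 - α) ^ k * (L.map f).prod

/-- The inner sum of `geomStar` is over a finite set. -/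
theorem factorizations_finite {σ : Type*} (k : ℕ) (w : List σ) : (factorizations k w).Finite := by
  induction k generalizing w with
  | zero =>
    refine (Set.finite_singleton []).subset ?_
    rintro L ⟨h, -⟩
    simpa using h
  | succ k ih =>
    refine ((Set.finite_Iic w.length).biUnion
      (fun i _ => (ih (w.drop i)).image (List.cons (w.take i)))).subset ?_
    rintro L ⟨h, hne, hw⟩
    cases L with
    | nil => simp at h
    | cons u L =>
      simp only [Set.mem_iUnion, Set.mem_image]
      refine ⟨u.length, ?_, L, ⟨by simpa using h, fun v hv => hne v (by simp [hv]), ?_⟩, ?_⟩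
      · simp [← hw]
      · simp [← hw]
      · simp [← hw]

/-- A word has no factorization into more nonempty words than its length. -/
theorem factorizations_eq_empty {σ : Type*} {k : ℕ} {w : List σ} (h : w.length < k) :
    factorizations k w = ∅ := by
  ext L
  simp only [Set.mem_empty_iff_false, iff_false]
  rintro ⟨rfl, hne, rfl⟩
  apply absurd h
  rw [not_lt, List.length_flatten]
  have := List.length_le_sum_of_one_le (L.map List.length) (by
    intro i hi
    obtain ⟨u, hu, rfl⟩ := List.mem_map.1 hi
    exact List.length_pos_iff.2 (hne u hu))
  simpa using this

/-- The outer sum of `geomStar` has only finitely many nonzero terms. -/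
theorem geomStar_summable {σ : Type*} (α : ℝ) (f : List σ → ℝ) (w : List σ) :
    Summable fun k : ℕ => ∑ᶠ L ∈ factorizations (k + 1) w, α * (1 - α) ^ k * (L.map f).prod := by
  refine summable_of_ne_finset_zero (s := Finset.range w.length) fun k hk => ?_
  rw [factorizations_eq_empty (by simpa [Nat.lt_succ_iff] using hk)]
  simp

/-- Stochastic regular expressions over the alphabet `σ`:
`r ::= δ_a ∣ α r₁ + (1 - α) r₂ ∣ r₁ · r₂ ∣ r*_α` with `a ∈ σ` and `α ∈ (0,1)`. -/
inductive StochRegExp (σ : Type*) where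
  | dirac (a : σ) : StochRegExp σ
  | convex (α : Set.Ioo (0 : ℝ) 1) (r₁ r₂ : StochRegExp σ) : StochRegExp σ
  | prod (r₁ r₂ : StochRegExp σ) : StochRegExp σ
  | star (α : Set.Ioo (0 : ℝ) 1) (r : StochRegExp σ) : StochRegExp σ

/-- The semantics of stochastic regular expressions. -/
noncomputable def StochRegExp.semantics {σ : Type*} : StochRegExp σ → List σ → ℝ
  | .dirac a => diracLang [a]
  | .convex α r₁ r₂ => fun w => (α : ℝ) * r₁.semantics w + (1 - (α : ℝ)) * r₂.semantics w
  | .prod r₁ r₂ => cauchyProd r₁.semantics r₂.semantics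
  | .star α r => geomStar (α : ℝ) r.semantics

/-! ### The algebra of the Cauchy product -/

section CauchyProduct

variable {σ : Type*}

/-! Both directions rest on the left-derivative rule `cauchyProd_cons` and on keeping track of total
mass. From expressions to automata, induct on the expression. Expressions vanish at ε, so an
automaton about to stop can instead read the first letter of a second automaton, or of a new round
of itself, without losing mass. The star is handled through its fixed-point equation `geomStar_eq`.
Conversely, the languages computed from the states of an automaton solve a linear system whose rows
have total mass 1. Gaussian elimination with Arden's lemma (`exists_loop_free`,
`isScaledRegularWithNil_of_linear_system`) solves it. The invariant is that row masses stay at most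
1: a loop of mass e < 1 can be replaced by a geometric star, while a loop of mass 1 leaves nothing
else in its row and forces the solution 0. A state may lose mass to infinite runs, so intermediate
languages are only scaled expressions plus multiples of δ_ε; the mass 1 of the final language
normalizes the result. -/

theorem diracLang_nil_nil : diracLang ([] : List σ) [] = 1 := by simp [diracLang]

theorem diracLang_nil_cons (a : σ) (w : List σ) : diracLang [] (a :: w) = 0 := by
  simp [diracLang]

theorem cauchyProd_nil (f g : List σ → ℝ) : cauchyProd f g [] = f [] * g [] := by
  simp [cauchyProd]

theorem cauchyProd_cons (f g : List σ → ℝ) (a : σ) (w : List σ) :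
    cauchyProd f g (a :: w) = f [] * g (a :: w) + cauchyProd (fun v => f (a :: v)) g w := by
  simp only [cauchyProd, List.length_cons]
  rw [Finset.sum_range_succ']
  simp [add_comm]

theorem cauchyProd_add (f g h : List σ → ℝ) :
    cauchyProd f (g + h) = cauchyProd f g + cauchyProd f h := by
  funext w
  simp [cauchyProd, mul_add, Finset.sum_add_distrib]

theorem add_cauchyProd (f g h : List σ → ℝ) :
    cauchyProd (f + g) h = cauchyProd f h + cauchyProd g h := by
  funext w
  simp [cauchyProd, add_mul, Finset.sum_add_distrib]

theorem cauchyProd_sub (f g h : List σ → ℝ) :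
    cauchyProd f (g - h) = cauchyProd f g - cauchyProd f h := by
  funext w
  simp [cauchyProd, mul_sub, Finset.sum_sub_distrib]

theorem cauchyProd_smul (c : ℝ) (f g : List σ → ℝ) :
    cauchyProd f (c • g) = c • cauchyProd f g := by
  funext w
  simp [cauchyProd, Finset.mul_sum, mul_left_comm]

theorem smul_cauchyProd (c : ℝ) (f g : List σ → ℝ) :
    cauchyProd (c • f) g = c • cauchyProd f g := by
  funext w
  simp [cauchyProd, Finset.mul_sum, mul_assoc]

theorem cauchyProd_zero (f : List σ → ℝ) : cauchyProd f 0 = 0 := by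
  funext w
  simp [cauchyProd]

theorem zero_cauchyProd (f : List σ → ℝ) : cauchyProd 0 f = 0 := by
  funext w
  simp [cauchyProd]

theorem cauchyProd_sum {ι : Type*} (s : Finset ι) (f : List σ → ℝ) (g : ι → List σ → ℝ) :
    cauchyProd f (∑ i ∈ s, g i) = ∑ i ∈ s, cauchyProd f (g i) := by
  classical
  induction s using Finset.induction_on with
  | empty => simp [cauchyProd_zero]
  | insert i s hi ih => simp [Finset.sum_insert hi, cauchyProd_add, ih]

theorem sum_cauchyProd {ι : Type*} (s : Finset ι) (f : ι → List σ → ℝ) (g : List σ → ℝ) :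
    cauchyProd (∑ i ∈ s, f i) g = ∑ i ∈ s, cauchyProd (f i) g := by
  classical
  induction s using Finset.induction_on with
  | empty => simp [zero_cauchyProd]
  | insert i s hi ih => simp [Finset.sum_insert hi, add_cauchyProd, ih]

theorem cauchyProd_dirac (f : List σ → ℝ) : cauchyProd f (diracLang []) = f := by
  funext w
  induction w generalizing f with
  | nil => simp [cauchyProd_nil, diracLang_nil_nil]
  | cons a w ih => simp [cauchyProd_cons, diracLang_nil_cons, ih]

theorem cauchyProd_assoc (f g h : List σ → ℝ) :
    cauchyProd (cauchyProd f g) h = cauchyProd f (cauchyProd g h) := by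
  funext w
  induction w generalizing f g with
  | nil => simp [cauchyProd_nil, mul_assoc]
  | cons a w ih =>
    have key : (fun v => cauchyProd f g (a :: v)) =
        f [] • (fun v => g (a :: v)) + cauchyProd (fun v => f (a :: v)) g := by
      funext v
      simp [cauchyProd_cons]
    rw [cauchyProd_cons, key, add_cauchyProd, smul_cauchyProd, Pi.add_apply, ih, cauchyProd_nil,
      cauchyProd_cons f, cauchyProd_cons g, Pi.smul_apply, smul_eq_mul]
    ring

theorem cauchyProd_nonneg {f g : List σ → ℝ} (hf : ∀ w, 0 ≤ f w) (hg : ∀ w, 0 ≤ g w)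
    (w : List σ) : 0 ≤ cauchyProd f g w :=
  Finset.sum_nonneg fun _ _ => mul_nonneg (hf _) (hg _)

/-- A homogeneous linear equation with a proper coefficient has only the zero solution. -/
theorem eq_zero_of_eq_cauchyProd {f g : List σ → ℝ} (hf : f [] = 0) (h : g = cauchyProd f g) :
    g = 0 := by
  -- Every surviving term of the product evaluates `g` at a strictly shorter word, since `f [] = 0`
  -- kills the empty prefix.
  have key : ∀ n, ∀ w : List σ, w.length = n → g w = 0 := by
    intro n
    induction n using Nat.strong_induction_on with
    | _ n ih =>
      intro w hw
      rw [h]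
      refine Finset.sum_eq_zero fun i hi => ?_
      rcases Nat.eq_zero_or_pos i with rfl | hi0
      · simp [hf]
      · rw [Finset.mem_range] at hi
        rw [ih (w.drop i).length (by rw [List.length_drop]; omega) _ rfl, mul_zero]
  exact funext fun w => key _ w rfl

/-- Arden's lemma: if `u = f + f · u`, then `r + u · r` is the solution of `g = r + f · g`. -/
theorem eq_of_eq_add_cauchyProd {f g r u : List σ → ℝ} (hf : f [] = 0)
    (hu : u = f + cauchyProd f u) (hg : g = r + cauchyProd f g) :
    g = r + cauchyProd u r := by
  -- This shows that `r + u · r` also solves the equation; the difference of the two solutions is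
  -- homogeneous, hence zero.
  have h0 : cauchyProd u r = cauchyProd f r + cauchyProd f (cauchyProd u r) := by
    conv_lhs => rw [hu, add_cauchyProd, cauchyProd_assoc]
  rw [← sub_eq_zero]
  apply eq_zero_of_eq_cauchyProd hf
  rw [cauchyProd_sub, cauchyProd_add, ← h0]
  conv_lhs => rw [hg]
  abel

/-- The cutting of a word at a position amounts to a pair of words. -/
noncomputable def splitEquiv (σ : Type*) : (Σ w : List σ, Fin (w.length + 1)) ≃ List σ × List σ :=
  Equiv.ofBijective (fun p => (p.1.take p.2, p.1.drop p.2)) <| by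
    constructor
    · rintro ⟨w, i⟩ ⟨w', i'⟩ h
      simp only [Prod.mk.injEq] at h
      obtain rfl : w = w' := by
        rw [← List.take_append_drop i w, h.1, h.2, List.take_append_drop]
      have h1 := congrArg List.length h.1
      simp only [List.length_take] at h1
      obtain rfl : i = i' := by
        ext
        omega
      rfl
    · rintro ⟨u, v⟩
      exact ⟨⟨u ++ v, ⟨u.length, by simp⟩⟩, by simp⟩

/-- Nonnegativity makes the double family over pairs of words summable; regrouping the pairs by
their concatenation gives the Cauchy product. -/
theorem hasSum_cauchyProd {f g : List σ → ℝ} {x y : ℝ} (hf : ∀ w, 0 ≤ f w) (hg : ∀ w, 0 ≤ g w)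
    (hfx : HasSum f x) (hgy : HasSum g y) : HasSum (cauchyProd f g) (x * y) := by
  have h1 : HasSum (fun p : List σ × List σ => f p.1 * g p.2) (x * y) :=
    hfx.mul hgy (hfx.summable.mul_of_nonneg hgy.summable hf hg)
  have h2 := ((splitEquiv σ).hasSum_iff).2 h1
  refine h2.sigma fun w => ?_
  have h3 := hasSum_fintype (fun i : Fin (w.length + 1) => f (w.take i) * g (w.drop i))
  rw [Fin.sum_univ_eq_sum_range (fun i => f (w.take i) * g (w.drop i))] at h3
  exact h3

/-! ### The geometric star -/

/-- The `k`-th Cauchy power, for the factorizations into nonempty words. -/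
noncomputable def wordPow (f : List σ → ℝ) (k : ℕ) (w : List σ) : ℝ :=
  ∑ᶠ L ∈ factorizations k w, (L.map f).prod

theorem wordPow_zero (f : List σ → ℝ) : wordPow f 0 = diracLang [] := by
  funext w
  cases w with
  | nil =>
    have : factorizations 0 ([] : List σ) = {[]} := by
      ext L
      simp only [factorizations, Set.mem_ofPred_eq, Set.mem_singleton_iff, List.length_eq_zero_iff]
      constructor
      · exact fun h => h.1
      · rintro rfl
        simp
    simp [wordPow, this, diracLang]
  | cons a w =>
    have : factorizations 0 (a :: w) = ∅ := by
      ext L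
      simp only [factorizations, Set.mem_ofPred_eq, Set.mem_empty_iff_false, iff_false,
        List.length_eq_zero_iff]
      rintro ⟨rfl, -, h⟩
      simp at h
    simp [wordPow, this, diracLang]

theorem factorizations_succ (k : ℕ) (w : List σ) :
    factorizations (k + 1) w =
      ⋃ i ∈ Set.Icc 1 w.length, List.cons (w.take i) '' factorizations k (w.drop i) := by
  ext L
  simp only [Set.mem_iUnion, Set.mem_image, exists_prop]
  constructor
  · rintro ⟨h, hne, hw⟩
    cases L with
    | nil => simp at h
    | cons u L =>
      have hu : 0 < u.length := List.length_pos_iff.2 (hne u (by simp))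
      refine ⟨u.length, ⟨hu, by simp [← hw]⟩, L,
        ⟨by simpa using h, fun v hv => hne v (by simp [hv]), ?_⟩, ?_⟩
      · simp [← hw]
      · simp [← hw]
  · rintro ⟨i, ⟨hi, hiw⟩, L, ⟨hl, hne, hw⟩, rfl⟩
    refine ⟨by simp [hl], ?_, by simp [hw]⟩
    intro u hu
    rcases List.mem_cons.1 hu with rfl | hu
    · rw [← List.length_pos_iff, List.length_take]
      omega
    · exact hne u hu

/-- Factorizations are sorted by the length of their first block. That block is nonempty, and `f []
= 0` makes the missing term of the Cauchy product vanish. -/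
theorem wordPow_succ {f : List σ → ℝ} (hf : f [] = 0) (k : ℕ) :
    wordPow f (k + 1) = cauchyProd f (wordPow f k) := by
  funext w
  rw [wordPow, factorizations_succ, finsum_mem_biUnion]
  · rw [finsum_mem_eq_finite_toFinset_sum _ (Set.finite_Icc 1 w.length)]
    have hset : (Set.finite_Icc 1 w.length).toFinset = (Finset.range (w.length + 1)).erase 0 := by
      ext i
      simp
      omega
    rw [hset, cauchyProd, ← Finset.sum_erase (a := 0) (Finset.range (w.length + 1)) (by simp [hf])]
    refine Finset.sum_congr rfl fun i _ => ?_
    rw [finsum_mem_image (List.cons_injective.injOn), wordPow, mul_finsum_mem]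
    simp only [List.map_cons, List.prod_cons]
  -- Prefixes of different lengths `i, j ≤ w.length` differ, so the pieces of the union are
  -- disjoint.
  · rintro i ⟨-, hi⟩ j ⟨-, hj⟩ hij
    rw [Function.onFun, Set.disjoint_left]
    rintro _ ⟨L, -, rfl⟩ ⟨L', -, h⟩
    have h1 := congrArg List.length (List.cons.inj h).1
    simp only [List.length_take] at h1
    omega
  · exact Set.finite_Icc _ _
  · exact fun i _ => (factorizations_finite _ _).image _

theorem wordPow_nonneg {f : List σ → ℝ} (hf : ∀ w, 0 ≤ f w) (k : ℕ) (w : List σ) :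
    0 ≤ wordPow f k w :=
  finsum_mem_induction (fun x : ℝ => 0 ≤ x) le_rfl (fun _ _ => add_nonneg) fun L _ =>
    List.prod_nonneg fun x hx => by
      obtain ⟨u, -, rfl⟩ := List.mem_map.1 hx
      exact hf u

theorem geomStar_term (α : ℝ) (f : List σ → ℝ) (w : List σ) (k : ℕ) :
    ∑ᶠ L ∈ factorizations (k + 1) w, α * (1 - α) ^ k * (L.map f).prod =
      α * (1 - α) ^ k * wordPow f (k + 1) w := by
  rw [wordPow, mul_finsum_mem]

theorem geomStar_eq_tsum (α : ℝ) (f : List σ → ℝ) (w : List σ) :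
    geomStar α f w = ∑' k : ℕ, α * (1 - α) ^ k * wordPow f (k + 1) w := by
  simp only [geomStar, geomStar_term]

theorem summable_geomStar_terms (α : ℝ) (f : List σ → ℝ) (w : List σ) :
    Summable fun k : ℕ => α * (1 - α) ^ k * wordPow f (k + 1) w := by
  simpa only [geomStar_term] using geomStar_summable α f w

/-- Split off the term with one factor, and take the first factor out of all the others. This
fixed-point equation stands in for the series from here on, except for nonnegativity and total mass.
-/
theorem geomStar_eq {f : List σ → ℝ} (hf : f [] = 0) (α : ℝ) :
    geomStar α f = α • f + (1 - α) • cauchyProd f (geomStar α f) := by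
  funext w
  rw [geomStar_eq_tsum, (summable_geomStar_terms α f w).tsum_eq_zero_add]
  have h1 : wordPow f (0 + 1) = f := by rw [wordPow_succ hf, wordPow_zero, cauchyProd_dirac]
  rw [h1]
  have h2 : cauchyProd f (geomStar α f) w =
      ∑' k : ℕ, α * (1 - α) ^ k * wordPow f (k + 1 + 1) w := by
    simp only [cauchyProd, geomStar_eq_tsum, wordPow_succ hf (_ + 1), Finset.mul_sum,
      ← tsum_mul_left]
    rw [← Summable.tsum_finsetSum]
    · refine tsum_congr fun k => Finset.sum_congr rfl fun i _ => ?_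
      ring
    · exact fun i _ => (summable_geomStar_terms α f _).mul_left _
  simp only [Pi.add_apply, Pi.smul_apply, smul_eq_mul, h2, ← tsum_mul_left, pow_zero, mul_one]
  congr 1
  refine tsum_congr fun k => ?_
  ring

theorem geomStar_nil {f : List σ → ℝ} (hf : f [] = 0) (α : ℝ) : geomStar α f [] = 0 := by
  rw [geomStar_eq hf]
  simp [cauchyProd_nil, hf]

theorem geomStar_nonneg {f : List σ → ℝ} (hf : ∀ w, 0 ≤ f w) {α : ℝ} (h0 : 0 ≤ α) (h1 : α ≤ 1)
    (w : List σ) : 0 ≤ geomStar α f w := by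
  rw [geomStar_eq_tsum]
  exact tsum_nonneg fun k =>
    mul_nonneg (mul_nonneg h0 (pow_nonneg (by linarith) _)) (wordPow_nonneg hf _ _)

/-! ### Total masses -/

theorem hasSum_diracLang (u : List σ) : HasSum (diracLang u) 1 := by
  classical
  have h := hasSum_ite_eq u (1 : ℝ)
  convert h using 1
  funext w
  simp [diracLang]

theorem hasSum_wordPow {f : List σ → ℝ} (hf : IsStochasticLanguage f) (h0 : f [] = 0) (k : ℕ) :
    HasSum (wordPow f k) 1 := by
  induction k with
  | zero => rw [wordPow_zero]; exact hasSum_diracLang []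
  | succ k ih =>
    rw [wordPow_succ h0]
    simpa using hasSum_cauchyProd hf.1 (wordPow_nonneg hf.1 k) hf.2 ih

/-- Tonelli: summed over words first, the k-th layer has mass `α * (1 - α) ^ k`, and these form a
geometric series of sum 1. -/
theorem hasSum_geomStar {f : List σ → ℝ} (hf : IsStochasticLanguage f) (h0 : f [] = 0) {α : ℝ}
    (hα0 : 0 < α) (hα1 : α < 1) : HasSum (geomStar α f) 1 := by
  have hgeom : HasSum (fun k : ℕ => α * (1 - α) ^ k) 1 := by
    have h := (hasSum_geometric_of_lt_one (r := 1 - α) (by linarith) (by linarith)).mul_left α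
    rwa [sub_sub_cancel, mul_inv_cancel₀ hα0.ne'] at h
  have hrow (k : ℕ) : HasSum (fun w => α * (1 - α) ^ k * wordPow f (k + 1) w)
      (α * (1 - α) ^ k) := by
    simpa using (hasSum_wordPow hf h0 (k + 1)).mul_left (α * (1 - α) ^ k)
  have hs : Summable fun p : ℕ × List σ => α * (1 - α) ^ p.1 * wordPow f (p.1 + 1) p.2 := by
    rw [summable_prod_of_nonneg]
    · refine ⟨fun k => (hrow k).summable, ?_⟩
      simp only [(hrow _).tsum_eq]
      exact hgeom.summable
    · exact fun p => mul_nonneg (mul_nonneg hα0.le (pow_nonneg (by linarith) _))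
        (wordPow_nonneg hf.1 _ _)
  have h1 : HasSum (fun p : ℕ × List σ => α * (1 - α) ^ p.1 * wordPow f (p.1 + 1) p.2) 1 := by
    have h2 := hs.hasSum
    rwa [(h2.prod_fiberwise hrow).unique hgeom] at h2
  refine ((Equiv.prodComm _ _).hasSum_iff.2 h1).prod_fiberwise fun w => ?_
  rw [geomStar_eq_tsum]
  exact (summable_geomStar_terms α f w).hasSum

end CauchyProduct

/-! ### The languages of stochastic regular expressions -/

theorem StochRegExp.semantics_nil {σ : Type*} (r : StochRegExp σ) : r.semantics [] = 0 := by
  induction r with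
  | dirac a => simp [semantics, diracLang]
  | convex α r s hr hs => simp [semantics, hr, hs]
  | prod r s hr hs => simp [semantics, cauchyProd_nil, hr]
  | star α r hr => exact geomStar_nil hr _

theorem StochRegExp.isStochasticLanguage {σ : Type*} (r : StochRegExp σ) :
    IsStochasticLanguage r.semantics := by
  induction r with
  | dirac a =>
    refine ⟨fun w => ?_, hasSum_diracLang _⟩
    rw [semantics, diracLang]
    split_ifs <;> norm_num
  | convex α r s hr hs =>
    refine ⟨fun w => add_nonneg (mul_nonneg α.2.1.le (hr.1 w))
      (mul_nonneg (sub_nonneg.2 α.2.2.le) (hs.1 w)), ?_⟩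
    have h := (hr.2.mul_left (α : ℝ)).add (hs.2.mul_left (1 - (α : ℝ)))
    simpa [semantics] using h
  | prod r s hr hs =>
    refine ⟨cauchyProd_nonneg hr.1 hs.1, ?_⟩
    simpa [semantics] using hasSum_cauchyProd hr.1 hs.1 hr.2 hs.2
  | star α r hr =>
    exact ⟨geomStar_nonneg hr.1 α.2.1.le α.2.2.le,
      hasSum_geomStar hr r.semantics_nil α.2.1 α.2.2⟩

/-! ### From stochastic regular expressions to probabilistic automata -/

section Automata

variable {σ : Type*} [Fintype σ]

/-- The weights of a probabilistic automaton, as real numbers, with the languages `g q` computed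
from the states `q`. -/
structure IsResidualSystem {Q : Type*} [Fintype Q] (i t : Q → ℝ) (m : σ → Q → Q → ℝ)
    (g : Q → List σ → ℝ) : Prop where
  init_nonneg : ∀ q, 0 ≤ i q
  final_nonneg : ∀ q, 0 ≤ t q
  trans_nonneg : ∀ a q q', 0 ≤ m a q q'
  sum_init : ∑ q, i q = 1
  sum_row : ∀ q, t q + ∑ a, ∑ q', m a q q' = 1
  nil : ∀ q, g q [] = t q
  cons : ∀ q a w, g q (a :: w) = ∑ q', m a q q' * g q' w

/-- The equations `nil` and `cons` determine `g` by induction on words. Building an automaton thus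
amounts to guessing the language of each state and checking these two equations, with real weights.
-/
theorem computedByProbAutomaton_iff (f : List σ → ℝ) :
    ComputedByProbAutomaton f ↔
      ∃ (Q : Type) (_ : Fintype Q) (i t : Q → ℝ) (m : σ → Q → Q → ℝ) (g : Q → List σ → ℝ),
        IsResidualSystem i t m g ∧ f = ∑ q, i q • g q := by
  constructor
  · rintro ⟨Q, _, A, ⟨h1, h2⟩, hf⟩
    refine ⟨Q, _, fun q => A.init q, fun q => A.final q, fun a q q' => A.trans a q q',
      fun q w => A.value w q, ⟨fun _ => NNReal.coe_nonneg _, fun _ => NNReal.coe_nonneg _,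
      fun _ _ _ => NNReal.coe_nonneg _, by exact_mod_cast h1, fun q => by exact_mod_cast h2 q,
      fun q => rfl, fun q a w => ?_⟩, ?_⟩
    · simp [WeightedAutomaton.value, Matrix.mulVec, dotProduct]
    · funext w
      simp [hf, WeightedAutomaton.semantics, dotProduct]
  · rintro ⟨Q, _, i, t, m, g, h, rfl⟩
    let A : WeightedAutomaton ℝ≥0 σ Q :=
      ⟨fun q => ⟨i q, h.init_nonneg q⟩, fun a q q' => ⟨m a q q', h.trans_nonneg a q q'⟩,
        fun q => ⟨t q, h.final_nonneg q⟩⟩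
    have hv (w : List σ) (q : Q) : (A.value w q : ℝ) = g q w := by
      induction w generalizing q with
      | nil => exact (h.nil q).symm
      | cons a w ih =>
        rw [h.cons]
        simp only [WeightedAutomaton.value, Matrix.mulVec, dotProduct, NNReal.coe_sum,
          NNReal.coe_mul, ih]
        rfl
    refine ⟨Q, inferInstance, A, ⟨?_, fun q => ?_⟩, fun w => ?_⟩
    · apply NNReal.coe_injective
      push_cast
      exact h.sum_init
    · apply NNReal.coe_injective
      push_cast
      exact h.sum_row q
    · simp only [WeightedAutomaton.semantics, dotProduct, NNReal.coe_sum, NNReal.coe_mul, hv,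
        Finset.sum_apply, Pi.smul_apply, smul_eq_mul]
      rfl

namespace IsResidualSystem

variable {Q : Type*} [Fintype Q] {i t : Q → ℝ} {m : σ → Q → Q → ℝ} {g : Q → List σ → ℝ}

theorem semantics_nil (h : IsResidualSystem i t m g) : (∑ q, i q • g q) [] = ∑ q, i q * t q := by
  simp [h.nil]

/-- Mass that does not stop at once must read a letter. When the language vanishes at ε, the weights
`∑ q, i q * m a q p` of entering `p` by the letter `a` therefore form a probability distribution. -/
theorem sum_first_letter (h : IsResidualSystem i t m g) :
    ∑ a, ∑ p, ∑ q, i q * m a q p = 1 - (∑ q, i q • g q) [] := by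
  rw [h.semantics_nil, ← h.sum_init, ← Finset.sum_sub_distrib]
  calc ∑ a, ∑ p, ∑ q, i q * m a q p
      = ∑ a, ∑ q, ∑ p, i q * m a q p := Finset.sum_congr rfl fun a _ => Finset.sum_comm
    _ = ∑ q, ∑ a, ∑ p, i q * m a q p := Finset.sum_comm
    _ = ∑ q, (i q - i q * t q) := by
      refine Finset.sum_congr rfl fun q _ => ?_
      simp only [← Finset.mul_sum]
      linear_combination i q * h.sum_row q

theorem semantics_cons (h : IsResidualSystem i t m g) (a : σ) (w : List σ) :
    (∑ q, i q • g q) (a :: w) = ∑ p, (∑ q, i q * m a q p) * g p w := by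
  simp only [Finset.sum_apply, Pi.smul_apply, smul_eq_mul, h.cons, Finset.mul_sum, Finset.sum_mul]
  rw [Finset.sum_comm]
  simp only [mul_assoc]

theorem first_letter_nonneg (h : IsResidualSystem i t m g) (a : σ) (p : Q) :
    0 ≤ ∑ q, i q * m a q p :=
  Finset.sum_nonneg fun _ _ => mul_nonneg (h.init_nonneg _) (h.trans_nonneg _ _ _)

theorem cauchyProd_cons (h : IsResidualSystem i t m g) (q : Q) (f : List σ → ℝ) (a : σ)
    (w : List σ) :
    cauchyProd (g q) f (a :: w) = t q * f (a :: w) + ∑ q', m a q q' * cauchyProd (g q') f w := by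
  have : (fun v => g q (a :: v)) = ∑ q', m a q q' • g q' := by
    funext v
    simp [h.cons]
  rw [_root_.cauchyProd_cons, this, h.nil, sum_cauchyProd]
  simp [smul_cauchyProd]

end IsResidualSystem

theorem computed_diracLang_nil : ComputedByProbAutomaton (diracLang ([] : List σ)) := by
  rw [computedByProbAutomaton_iff]
  refine ⟨Unit, inferInstance, fun _ => 1, fun _ => 1, fun _ _ _ => 0, fun _ => diracLang [],
    ⟨?_, ?_, ?_, ?_, ?_, ?_, ?_⟩, ?_⟩ <;> simp [diracLang]

theorem computed_diracLang_singleton (a : σ) : ComputedByProbAutomaton (diracLang [a]) := by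
  classical
  rw [computedByProbAutomaton_iff]
  refine ⟨Bool, inferInstance, fun q => if q then 1 else 0, fun q => if q then 0 else 1,
    fun b q q' => if q = true ∧ q' = false ∧ b = a then 1 else 0,
    fun q => if q then diracLang [a] else diracLang [], ⟨?_, ?_, ?_, ?_, ?_, ?_, ?_⟩, ?_⟩
  · intro q
    cases q <;> simp
  · intro q
    cases q <;> simp
  · intro b q q'
    split_ifs <;> norm_num
  · simp
  · intro q
    cases q <;> simp [-Finset.sum_boole]
  · intro q
    cases q <;> simp [diracLang]
  · intro q b w
    cases q
    · simp [diracLang]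
    · by_cases h : b = a <;> simp [diracLang, h]
  · simp

theorem ComputedByProbAutomaton.convex {f₁ f₂ : List σ → ℝ} (h₁ : ComputedByProbAutomaton f₁)
    (h₂ : ComputedByProbAutomaton f₂) {c : ℝ} (hc0 : 0 ≤ c) (hc1 : c ≤ 1) :
    ComputedByProbAutomaton (c • f₁ + (1 - c) • f₂) := by
  rw [computedByProbAutomaton_iff] at h₁ h₂ ⊢
  obtain ⟨Q₁, _, i₁, t₁, m₁, g₁, h₁, rfl⟩ := h₁
  obtain ⟨Q₂, _, i₂, t₂, m₂, g₂, h₂, rfl⟩ := h₂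
  refine ⟨Q₁ ⊕ Q₂, inferInstance, Sum.elim (c • i₁) ((1 - c) • i₂), Sum.elim t₁ t₂,
    fun a => Sum.elim (fun q => Sum.elim (m₁ a q) 0) (fun q => Sum.elim 0 (m₂ a q)),
    Sum.elim g₁ g₂, ⟨?_, ?_, ?_, ?_, ?_, ?_, ?_⟩, ?_⟩
  · rintro (q | q)
    · exact mul_nonneg hc0 (h₁.init_nonneg q)
    · exact mul_nonneg (by linarith) (h₂.init_nonneg q)
  · rintro (q | q)
    · exact h₁.final_nonneg q
    · exact h₂.final_nonneg q
  · rintro a (q | q) (q' | q')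
    · exact h₁.trans_nonneg a q q'
    · exact le_rfl
    · exact le_rfl
    · exact h₂.trans_nonneg a q q'
  · simp [← Finset.mul_sum, h₁.sum_init, h₂.sum_init]
  · rintro (q | q)
    · simpa using h₁.sum_row q
    · simpa using h₂.sum_row q
  · rintro (q | q)
    · exact h₁.nil q
    · exact h₂.nil q
  · rintro (q | q) a w
    · simpa using h₁.cons q a w
    · simpa using h₂.cons q a w
  · simp [Finset.smul_sum, mul_smul]

theorem ComputedByProbAutomaton.cauchyProd {f₁ f₂ : List σ → ℝ}
    (h₁ : ComputedByProbAutomaton f₁) (h₂ : ComputedByProbAutomaton f₂) (h0 : f₂ [] = 0) :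
    ComputedByProbAutomaton (cauchyProd f₁ f₂) := by
  rw [computedByProbAutomaton_iff] at h₁ h₂ ⊢
  obtain ⟨Q₁, _, i₁, t₁, m₁, g₁, h₁, rfl⟩ := h₁
  obtain ⟨Q₂, _, i₂, t₂, m₂, g₂, h₂, rfl⟩ := h₂
  -- The stopping weight `t₁ q` is redistributed over the first steps of the second automaton, so a
  -- state `q` of the first computes `g₁ q · f₂`. No mass is lost, because `f₂ [] = 0`.
  refine ⟨Q₁ ⊕ Q₂, inferInstance, Sum.elim i₁ 0, Sum.elim 0 t₂,
    fun a => Sum.elim (fun q => Sum.elim (m₁ a q) (fun p => t₁ q * ∑ r, i₂ r * m₂ a r p))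
      (fun q => Sum.elim 0 (m₂ a q)),
    Sum.elim (fun q => _root_.cauchyProd (g₁ q) (∑ r, i₂ r • g₂ r)) g₂,
    ⟨?_, ?_, ?_, ?_, ?_, ?_, ?_⟩, ?_⟩
  · rintro (q | q)
    · exact h₁.init_nonneg q
    · exact le_rfl
  · rintro (q | q)
    · exact le_rfl
    · exact h₂.final_nonneg q
  · rintro a (q | q) (q' | q')
    · exact h₁.trans_nonneg a q q'
    · exact mul_nonneg (h₁.final_nonneg q) (h₂.first_letter_nonneg a q')
    · exact le_rfl
    · exact h₂.trans_nonneg a q q'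
  · simp [h₁.sum_init]
  · rintro (q | q)
    · have h3 := h₂.sum_first_letter
      rw [h0, sub_zero] at h3
      simp only [Sum.elim_inl, Pi.zero_apply, Fintype.sum_sum_type, Sum.elim_inr,
        Finset.sum_add_distrib, ← Finset.mul_sum _ _ (t₁ q), h3]
      linear_combination h₁.sum_row q
    · simpa using h₂.sum_row q
  · rintro (q | q)
    · simp only [Sum.elim_inl, cauchyProd_nil, h0, mul_zero, Pi.zero_apply]
    · exact h₂.nil q
  · rintro (q | q) a w
    · simp only [Sum.elim_inl, Fintype.sum_sum_type, Sum.elim_inr]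
      rw [h₁.cauchyProd_cons, h₂.semantics_cons, Finset.mul_sum, add_comm]
      simp only [mul_assoc]
    · simpa using h₂.cons q a w
  · rw [sum_cauchyProd]
    simp [smul_cauchyProd]

theorem ComputedByProbAutomaton.geomStar {f : List σ → ℝ}
    (h : ComputedByProbAutomaton f) (h0 : f [] = 0) {α : ℝ} (hα0 : 0 ≤ α) (hα1 : α ≤ 1) :
    ComputedByProbAutomaton (geomStar α f) := by
  have hS := geomStar_eq h0 α
  have hS0 := geomStar_nil h0 α
  rw [computedByProbAutomaton_iff] at h ⊢
  obtain ⟨Q, _, i, t, m, g, h, rfl⟩ := h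
  set S := _root_.geomStar α (∑ q, i q • g q) with hSdef
  have hsum : S = ∑ q, i q • (α • g q + (1 - α) • _root_.cauchyProd (g q) S) := by
    rw [hS]
    conv_lhs => rw [sum_cauchyProd, Finset.smul_sum, Finset.smul_sum, ← Finset.sum_add_distrib]
    refine Finset.sum_congr rfl fun q _ => ?_
    rw [smul_cauchyProd, smul_add, smul_comm α, smul_comm (1 - α), ← hS]
  have hcons (a : σ) (w : List σ) : S (a :: w) = ∑ p, (∑ q, i q * m a q p) *
      (α • g p + (1 - α) • _root_.cauchyProd (g p) S) w := by
    -- A sum of nonnegative terms equal to `f [] = 0`: an initial state of positive weight cannot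
    -- stop. This removes the terms `t q * S (a :: w)` below.
    have h0' : ∀ q, i q * t q = 0 := by
      rw [h.semantics_nil, Finset.sum_eq_zero_iff_of_nonneg
        fun q _ => mul_nonneg (h.init_nonneg q) (h.final_nonneg q)] at h0
      exact fun q => h0 q (Finset.mem_univ q)
    conv_lhs => rw [hsum]
    simp only [Finset.sum_apply, Pi.smul_apply, Pi.add_apply, smul_eq_mul, h.cons,
      h.cauchyProd_cons, Finset.sum_mul]
    rw [Finset.sum_comm]
    refine Finset.sum_congr rfl fun q _ => ?_
    have h1 := h0' q
    simp only [mul_add, Finset.sum_add_distrib, Finset.mul_sum]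
    rw [show i q * ((1 - α) * (t q * S (a :: w))) = 0 by
      linear_combination (1 - α) * S (a :: w) * h1, zero_add]
    congr 1 <;> exact Finset.sum_congr rfl fun _ _ => by ring
  -- Where the old automaton stops, the new one stops with probability `α` and otherwise starts a
  -- new round by its first letter. The language of `q` finishes the current round, then ends or
  -- appends a further `S`.
  refine ⟨Q, inferInstance, i, α • t,
    fun a q p => m a q p + (1 - α) * (t q * ∑ r, i r * m a r p),
    fun q => α • g q + (1 - α) • _root_.cauchyProd (g q) S,
    ⟨h.init_nonneg, ?_, ?_, h.sum_init, ?_, ?_, ?_⟩, hsum⟩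
  · exact fun q => mul_nonneg hα0 (h.final_nonneg q)
  · exact fun a q p => add_nonneg (h.trans_nonneg a q p) (mul_nonneg (by linarith)
      (mul_nonneg (h.final_nonneg q) (h.first_letter_nonneg a p)))
  · intro q
    have h3 := h.sum_first_letter
    rw [h0, sub_zero] at h3
    simp only [Finset.sum_add_distrib, ← Finset.mul_sum _ _ (t q),
      ← Finset.mul_sum _ _ (1 - α), h3, Pi.smul_apply, smul_eq_mul]
    linear_combination h.sum_row q
  · intro q
    simp [cauchyProd_nil, hS0, h.nil]
  · intro q a w
    simp only [add_mul, Finset.sum_add_distrib]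
    have h4 : ∑ p, (1 - α) * (t q * ∑ r, i r * m a r p) *
        (α • g p + (1 - α) • _root_.cauchyProd (g p) S) w = (1 - α) * (t q * S (a :: w)) := by
      rw [hcons, Finset.mul_sum, Finset.mul_sum]
      exact Finset.sum_congr rfl fun _ _ => by ring
    rw [h4]
    simp only [Pi.smul_apply, Pi.add_apply, smul_eq_mul, h.cons, h.cauchyProd_cons, mul_add,
      Finset.sum_add_distrib, Finset.mul_sum, mul_left_comm α, mul_left_comm (1 - α)]
    ring

theorem StochRegExp.computedByProbAutomaton (r : StochRegExp σ) :
    ComputedByProbAutomaton r.semantics := by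
  induction r with
  | dirac a => exact computed_diracLang_singleton a
  | convex α r s hr hs => exact hr.convex hs α.2.1.le α.2.2.le
  | prod r s hr hs => exact hr.cauchyProd hs s.semantics_nil
  | star α r hr => exact hr.geomStar r.semantics_nil α.2.1.le α.2.2.le

end Automata

/-! ### From probabilistic automata to stochastic regular expressions -/

section Elimination

variable {σ : Type*}

/-- `f` is a nonnegative multiple, by `c`, of the language of a stochastic regular expression. -/
def IsScaledRegular (c : ℝ) (f : List σ → ℝ) : Prop :=
  (c = 0 ∧ f = 0) ∨ (0 < c ∧ ∃ r : StochRegExp σ, f = c • r.semantics)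

/-- `f` is the sum of a nonnegative multiple of `δ_ε` and of a scaled regular language,
of total mass `c`. -/
def IsScaledRegularWithNil (c : ℝ) (f : List σ → ℝ) : Prop :=
  ∃ x y : ℝ, ∃ g : List σ → ℝ, 0 ≤ x ∧ IsScaledRegular y g ∧ c = x + y ∧ f = x • diracLang [] + g

namespace IsScaledRegular

variable {c d : ℝ} {f g : List σ → ℝ}

theorem zero : IsScaledRegular 0 (0 : List σ → ℝ) := .inl ⟨rfl, rfl⟩

theorem of_semantics (r : StochRegExp σ) : IsScaledRegular 1 r.semantics :=
  .inr ⟨one_pos, r, (one_smul _ _).symm⟩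

theorem nonneg (h : IsScaledRegular c f) : 0 ≤ c := by
  rcases h with ⟨rfl, -⟩ | ⟨h, -⟩
  exacts [le_rfl, h.le]

theorem eq_zero (h : IsScaledRegular c f) (hc : c = 0) : f = 0 := by
  rcases h with ⟨-, h⟩ | ⟨h, -⟩
  exacts [h, absurd hc h.ne']

theorem apply_nil (h : IsScaledRegular c f) : f [] = 0 := by
  rcases h with ⟨-, rfl⟩ | ⟨-, r, rfl⟩
  · rfl
  · simp [r.semantics_nil]

theorem hasSum (h : IsScaledRegular c f) : HasSum f c := by
  rcases h with ⟨rfl, rfl⟩ | ⟨-, r, rfl⟩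
  · exact hasSum_zero
  · have h := r.isStochasticLanguage.2.const_smul c
    rw [smul_eq_mul, mul_one] at h
    exact h

theorem smul (h : IsScaledRegular c f) {x : ℝ} (hx : 0 ≤ x) :
    IsScaledRegular (x * c) (x • f) := by
  rcases hx.eq_or_lt with rfl | hx
  · simpa using zero
  rcases h with ⟨rfl, rfl⟩ | ⟨hc, r, rfl⟩
  · simpa using zero
  · exact .inr ⟨mul_pos hx hc, r, smul_smul _ _ _⟩

theorem add (hf : IsScaledRegular c f) (hg : IsScaledRegular d g) :
    IsScaledRegular (c + d) (f + g) := by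
  rcases hf with ⟨rfl, rfl⟩ | ⟨hc, r, rfl⟩
  · simpa using hg
  rcases hg with ⟨rfl, rfl⟩ | ⟨hd, s, rfl⟩
  · rw [add_zero, add_zero]
    exact .inr ⟨hc, r, rfl⟩
  have hcd : 0 < c + d := add_pos hc hd
  -- The masses `c` and `d`, normalized, are the weights of the convex combination.
  refine .inr ⟨hcd, .convex ⟨c / (c + d), div_pos hc hcd, ?_⟩ r s, ?_⟩
  · rw [div_lt_one hcd]
    linarith
  · funext w
    simp only [StochRegExp.semantics, Pi.add_apply, Pi.smul_apply, smul_eq_mul]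
    field_simp
    ring

theorem sum {ι : Type*} (s : Finset ι) {c : ι → ℝ} {f : ι → List σ → ℝ}
    (h : ∀ i ∈ s, IsScaledRegular (c i) (f i)) :
    IsScaledRegular (∑ i ∈ s, c i) (∑ i ∈ s, f i) := by
  classical
  induction s using Finset.induction_on with
  | empty => simpa using zero
  | insert i s hi ih =>
    rw [Finset.sum_insert hi, Finset.sum_insert hi]
    exact (h i (by simp)).add (ih fun j hj => h j (by simp [hj]))

theorem cauchyProd (hf : IsScaledRegular c f) (hg : IsScaledRegular d g) :
    IsScaledRegular (c * d) (cauchyProd f g) := by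
  rcases hf with ⟨rfl, rfl⟩ | ⟨hc, r, rfl⟩
  · simpa [zero_cauchyProd] using zero
  rcases hg with ⟨rfl, rfl⟩ | ⟨hd, s, rfl⟩
  · simpa [cauchyProd_zero] using zero
  refine .inr ⟨mul_pos hc hd, .prod r s, ?_⟩
  rw [smul_cauchyProd, cauchyProd_smul, smul_smul]
  rfl

/-- A left factor vanishing at ε absorbs the δ_ε part on the right, so coefficients stay proper
during elimination. -/
theorem cauchyProd_withNil (hf : IsScaledRegular c f) (hg : IsScaledRegularWithNil d g) :
    IsScaledRegular (c * d) (_root_.cauchyProd f g) := by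
  obtain ⟨x, y, g, hx, hg, rfl, rfl⟩ := hg
  rw [cauchyProd_add, cauchyProd_smul, cauchyProd_dirac, mul_add, mul_comm c x]
  exact (hf.smul hx).add (hf.cauchyProd hg)

/-- The sum of the positive Cauchy powers of a scaled regular language of mass less than `1`. -/
theorem exists_plus (hf : IsScaledRegular c f) (hc : c < 1) :
    ∃ u, IsScaledRegular (c / (1 - c)) u ∧ u = f + _root_.cauchyProd f u := by
  rcases hf with ⟨rfl, rfl⟩ | ⟨hc0, r, rfl⟩
  · exact ⟨0, by simpa using zero, by simp [cauchyProd_zero]⟩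
  have h1 : 0 < 1 - c := by linarith
  -- With `α = 1 - c`, the k-th power has weight `(1 - c) * c ^ (k - 1)` in the star; the factor `c
  -- / (1 - c)` turns it into `c ^ k`, as needed for the powers of `c • r.semantics`.
  refine ⟨(c / (1 - c)) • geomStar (1 - c) r.semantics,
    .inr ⟨div_pos hc0 h1, .star ⟨1 - c, h1, by linarith⟩ r, rfl⟩, ?_⟩
  conv_lhs => rw [geomStar_eq r.semantics_nil]
  rw [smul_cauchyProd, cauchyProd_smul, smul_add, smul_smul, smul_smul, smul_smul, sub_sub_cancel,
    div_mul_cancel₀ _ h1.ne', mul_comm c]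

end IsScaledRegular

namespace IsScaledRegularWithNil

variable {c d : ℝ} {f g : List σ → ℝ}

theorem of_isScaledRegular (h : IsScaledRegular c f) : IsScaledRegularWithNil c f :=
  ⟨0, c, f, le_rfl, h, by simp, by simp⟩

theorem dirac : IsScaledRegularWithNil 1 (diracLang ([] : List σ)) :=
  ⟨1, 0, 0, zero_le_one, .zero, by simp, by simp⟩

theorem nonneg (h : IsScaledRegularWithNil c f) : 0 ≤ c := by
  obtain ⟨x, y, g, hx, hg, rfl, rfl⟩ := h
  exact add_nonneg hx hg.nonneg

theorem eq_zero (h : IsScaledRegularWithNil c f) (hc : c = 0) : f = 0 := by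
  obtain ⟨x, y, g, hx, hg, rfl, rfl⟩ := h
  have hy := hg.nonneg
  obtain rfl : x = 0 := by linarith
  simp [hg.eq_zero (by linarith)]

theorem hasSum (h : IsScaledRegularWithNil c f) : HasSum f c := by
  obtain ⟨x, y, g, hx, hg, rfl, rfl⟩ := h
  have h := ((hasSum_diracLang []).const_smul x).add hg.hasSum
  rw [smul_eq_mul, mul_one] at h
  exact h

theorem smul (h : IsScaledRegularWithNil c f) {x : ℝ} (hx : 0 ≤ x) :
    IsScaledRegularWithNil (x * c) (x • f) := by
  obtain ⟨y, z, g, hy, hg, rfl, rfl⟩ := h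
  exact ⟨x * y, x * z, x • g, mul_nonneg hx hy, hg.smul hx, mul_add _ _ _,
    by rw [smul_add, smul_smul]⟩

theorem add (hf : IsScaledRegularWithNil c f) (hg : IsScaledRegularWithNil d g) :
    IsScaledRegularWithNil (c + d) (f + g) := by
  obtain ⟨x, y, f, hx, hf, rfl, rfl⟩ := hf
  obtain ⟨x', y', g, hx', hg, rfl, rfl⟩ := hg
  refine ⟨x + x', y + y', f + g, add_nonneg hx hx', hf.add hg, by ring, ?_⟩
  rw [add_smul]
  abel

theorem sum {ι : Type*} (s : Finset ι) {c : ι → ℝ} {f : ι → List σ → ℝ}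
    (h : ∀ i ∈ s, IsScaledRegularWithNil (c i) (f i)) :
    IsScaledRegularWithNil (∑ i ∈ s, c i) (∑ i ∈ s, f i) := by
  classical
  induction s using Finset.induction_on with
  | empty => simpa using of_isScaledRegular .zero
  | insert i s hi ih =>
    rw [Finset.sum_insert hi, Finset.sum_insert hi]
    exact (h i (by simp)).add (ih fun j hj => h j (by simp [hj]))

end IsScaledRegularWithNil

/-- Elimination of the loop at an unknown of a linear equation with scaled regular coefficients. -/
theorem exists_loop_free {ι : Type*} [Fintype ι] {x f b : List σ → ℝ} {e z : ℝ}
    {y g : ι → List σ → ℝ} {d : ι → ℝ} (hf : IsScaledRegular e f) (hb : IsScaledRegularWithNil z b)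
    (hg : ∀ j, IsScaledRegular (d j) (g j)) (hm : z + (e + ∑ j, d j) ≤ 1)
    (hx : x = b + (cauchyProd f x + ∑ j, cauchyProd (g j) (y j))) :
    ∃ (b' : List σ → ℝ) (z' : ℝ) (g' : ι → List σ → ℝ) (d' : ι → ℝ),
      IsScaledRegularWithNil z' b' ∧ (∀ j, IsScaledRegular (d' j) (g' j)) ∧ z' + ∑ j, d' j ≤ 1 ∧
      x = b' + ∑ j, cauchyProd (g' j) (y j) := by
  have hd : ∀ j ∈ Finset.univ, 0 ≤ d j := fun j _ => (hg j).nonneg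
  have hd' := Finset.sum_nonneg hd
  have hz := hb.nonneg
  rcases lt_or_ge e 1 with he | he
  · obtain ⟨u, hu, hfu⟩ := hf.exists_plus he
    have h1 : 0 < 1 - e := by linarith
    -- Arden's solution: `u` collects the positive powers of the loop `f`, and is applied to the
    -- remaining terms.
    refine ⟨b + cauchyProd u b, z + e / (1 - e) * z, fun j => g j + cauchyProd u (g j),
      fun j => d j + e / (1 - e) * d j, hb.add (.of_isScaledRegular (hu.cauchyProd_withNil hb)),
      fun j => (hg j).add (hu.cauchyProd (hg j)), ?_, ?_⟩
    · rw [Finset.sum_add_distrib, ← Finset.mul_sum]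
      have h2 : z + e / (1 - e) * z + (∑ j, d j + e / (1 - e) * ∑ j, d j) =
          (z + ∑ j, d j) / (1 - e) := by
        field_simp
        ring
      -- The new row mass `(z + ∑ j, d j) / (1 - e)` is at most 1 exactly because the old one was.
      rw [h2, div_le_one h1]
      linarith
    · have hx' : x = (b + ∑ j, cauchyProd (g j) (y j)) + cauchyProd f x := by
        conv_lhs => rw [hx]
        abel
      rw [eq_of_eq_add_cauchyProd hf.apply_nil hfu hx']
      simp only [cauchyProd_add, add_cauchyProd, cauchyProd_sum, Finset.sum_add_distrib,
        cauchyProd_assoc]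
      abel
  -- A loop of mass at least 1 exhausts the row: all other coefficients vanish and `x = f · x`
  -- forces `x = 0`.
  · refine ⟨0, 0, 0, 0, .of_isScaledRegular .zero, fun _ => .zero, by simp, ?_⟩
    have hd0 := (Finset.sum_eq_zero_iff_of_nonneg hd).1 (by linarith)
    have hg0 (j : ι) : g j = 0 := (hg j).eq_zero (hd0 j (Finset.mem_univ j))
    have hb0 : b = 0 := hb.eq_zero (by linarith)
    rw [hb0] at hx
    simp only [hg0, zero_cauchyProd, Finset.sum_const_zero, add_zero, zero_add] at hx
    simpa [zero_cauchyProd] using eq_zero_of_eq_cauchyProd hf.apply_nil hx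

/-- The solutions of a substochastic linear system with scaled regular coefficients are scaled
regular languages, up to multiples of `δ_ε`. -/
theorem isScaledRegularWithNil_of_linear_system (n : ℕ) (x b : Fin n → List σ → ℝ)
    (f : Fin n → Fin n → List σ → ℝ) (z : Fin n → ℝ) (e : Fin n → Fin n → ℝ)
    (hb : ∀ i, IsScaledRegularWithNil (z i) (b i)) (hf : ∀ i j, IsScaledRegular (e i j) (f i j))
    (hm : ∀ i, z i + ∑ j, e i j ≤ 1) (hx : ∀ i, x i = b i + ∑ j, cauchyProd (f i j) (x j))
    (i : Fin n) : ∃ c, IsScaledRegularWithNil c (x i) := by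
  induction n with
  | zero => exact i.elim0
  | succ n ih =>
    -- Solve the first equation for `x 0` and substitute it into the others.
    obtain ⟨b', z', g', d', hb', hg', hm', hx'⟩ := exists_loop_free (y := fun j => x (Fin.succ j))
      (hf 0 0) (hb 0) (fun j : Fin n => hf 0 j.succ)
      (by simpa [Fin.sum_univ_succ] using hm 0) (by simpa [Fin.sum_univ_succ] using hx 0)
    have hsucc (i : Fin n) : ∃ c, IsScaledRegularWithNil c (x i.succ) := by
      refine ih (fun i => x i.succ) (fun i => b i.succ + cauchyProd (f i.succ 0) b')
        (fun i j => f i.succ j.succ + cauchyProd (f i.succ 0) (g' j))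
        (fun i => z i.succ + e i.succ 0 * z')
        (fun i j => e i.succ j.succ + e i.succ 0 * d' j)
        (fun i => (hb i.succ).add (.of_isScaledRegular ((hf _ _).cauchyProd_withNil hb')))
        (fun i j => (hf _ _).add ((hf _ _).cauchyProd (hg' j))) (fun i => ?_) (fun i => ?_) i
      · have h1 := hm i.succ
        rw [Fin.sum_univ_succ] at h1
        rw [Finset.sum_add_distrib, ← Finset.mul_sum]
        -- Substitution replaces the mass `e i.succ 0` by its product with `z' + ∑ j, d' j ≤ 1`, so
        -- the row mass does not grow.
        have h2 := mul_le_mul_of_nonneg_left hm' (hf i.succ 0).nonneg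
        linarith
      · have h1 := hx i.succ
        rw [Fin.sum_univ_succ, hx'] at h1
        simp only [h1, cauchyProd_add, add_cauchyProd, cauchyProd_sum, Finset.sum_add_distrib,
          cauchyProd_assoc]
        abel
    refine Fin.cases ?_ hsucc i
    choose c hc using hsucc
    rw [hx']
    exact ⟨_, hb'.add (.sum _ fun j _ =>
      .of_isScaledRegular ((hg' j).cauchyProd_withNil (hc j)))⟩

/-! ### The linear system of an automaton -/

theorem cauchyProd_diracLang_singleton_nil (a : σ) (f : List σ → ℝ) :
    cauchyProd (diracLang [a]) f [] = 0 := by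
  simp [cauchyProd_nil, diracLang]

theorem cauchyProd_diracLang_singleton_cons [DecidableEq σ] (a b : σ) (f : List σ → ℝ)
    (w : List σ) : cauchyProd (diracLang [a]) f (b :: w) = if a = b then f w else 0 := by
  by_cases h : a = b
  · subst h
    have : (fun v => diracLang [a] (a :: v)) = diracLang [] := by
      funext v
      simp [diracLang]
    rw [cauchyProd_cons, this]
    have h1 : cauchyProd (diracLang []) f w = f w := by
      cases w <;> simp [cauchyProd_nil, cauchyProd_cons, diracLang_nil_nil, diracLang_nil_cons]
      exact congrFun (zero_cauchyProd f) _
    simp [h1, diracLang]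
  · have : (fun v => diracLang [a] (b :: v)) = 0 := by
      funext v
      simp [diracLang, Ne.symm h]
    rw [cauchyProd_cons, this, zero_cauchyProd]
    simp [h, diracLang]

theorem IsResidualSystem.exists_isScaledRegularWithNil [Fintype σ] {Q : Type*} [Fintype Q]
    {i t : Q → ℝ} {m : σ → Q → Q → ℝ} {g : Q → List σ → ℝ} (h : IsResidualSystem i t m g) (q : Q) :
    ∃ c, IsScaledRegularWithNil c (g q) := by
  classical
  let φ := Fintype.equivFin Q
  -- The system is `g q = t q • δ_ε + ∑ p, (∑ a, m a q p • δ_a) · g p`; its row masses are those of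
  -- `sum_row`.
  have key := isScaledRegularWithNil_of_linear_system (Fintype.card Q) (fun j => g (φ.symm j))
    (fun j => t (φ.symm j) • diracLang [])
    (fun j k => ∑ a, m a (φ.symm j) (φ.symm k) • diracLang [a])
    (fun j => t (φ.symm j)) (fun j k => ∑ a, m a (φ.symm j) (φ.symm k))
    (fun j => by simpa using IsScaledRegularWithNil.dirac.smul (h.final_nonneg (φ.symm j)))
    (fun j k => .sum _ fun a _ => by
      simpa [StochRegExp.semantics] using
        (IsScaledRegular.of_semantics (.dirac a)).smul (h.trans_nonneg a (φ.symm j) (φ.symm k)))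
    (fun j => by
      rw [Finset.sum_comm]
      have h1 (a : σ) := φ.symm.sum_comp fun k => m a (φ.symm j) k
      simp only [h1]
      exact (h.sum_row _).le)
    (fun j => by
      rw [φ.symm.sum_comp fun k => cauchyProd (∑ a, m a (φ.symm j) k • diracLang [a]) (g k)]
      simp only [sum_cauchyProd, smul_cauchyProd]
      funext w
      cases w with
      | nil => simp [h.nil, diracLang_nil_nil, cauchyProd_diracLang_singleton_nil]
      | cons a w => simp [h.cons, diracLang_nil_cons, cauchyProd_diracLang_singleton_cons])
    (φ q)
  simpa using key

theorem ComputedByProbAutomaton.eq_dirac_or_exists [Fintype σ] {f : List σ → ℝ}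
    (h : ComputedByProbAutomaton f) (hf : HasSum f 1) :
    f = diracLang [] ∨ ∃ c ∈ Set.Ico (0 : ℝ) 1, ∃ r : StochRegExp σ,
      f = c • diracLang [] + (1 - c) • r.semantics := by
  rw [computedByProbAutomaton_iff] at h
  obtain ⟨Q, _, i, t, m, g, h, rfl⟩ := h
  choose c hc using h.exists_isScaledRegularWithNil
  have h1 := IsScaledRegularWithNil.sum Finset.univ fun q _ => (hc q).smul (h.init_nonneg q)
  -- The masses `c q` of the states are unknown, but the total is forced to be 1, so the two parts
  -- have weights `x` and `1 - x`.
  have h2 := h1.hasSum.unique hf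
  obtain ⟨x, y, s, hx, hs, hxy, hfs⟩ := h1
  rw [h2] at hxy
  rw [hfs]
  rcases hs with ⟨rfl, rfl⟩ | ⟨hy, r, rfl⟩
  · obtain rfl : x = 1 := by linarith
    simp
  · obtain rfl : y = 1 - x := by linarith
    exact .inr ⟨x, ⟨hx, by linarith⟩, r, rfl⟩

end Elimination

theorem theorem3p2 {σ : Type*} [Fintype σ] (f : List σ → ℝ) :
    ((ComputedByProbAutomaton f ∧ IsStochasticLanguage f ∧ f [] = 0) ↔
      ∃ r : StochRegExp σ, f = r.semantics) ∧
    ((ComputedByProbAutomaton f ∧ IsStochasticLanguage f) ↔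
      (f = diracLang [] ∨ ∃ c ∈ Set.Ico (0 : ℝ) 1, ∃ r : StochRegExp σ,
        ∀ w, f w = c * diracLang [] w + (1 - c) * r.semantics w)) := by
  have nonneg_dirac (w : List σ) : 0 ≤ diracLang [] w := by
    rw [diracLang]
    split_ifs <;> norm_num
  refine ⟨⟨?_, ?_⟩, ?_, ?_⟩
  · rintro ⟨h, hf, h0⟩
    rcases h.eq_dirac_or_exists hf.2 with rfl | ⟨c, hc, r, rfl⟩
    · simp [diracLang] at h0
    -- Expressions vanish at ε, so `f [] = c`.
    · obtain rfl : c = 0 := by simpa [diracLang, r.semantics_nil] using h0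
      exact ⟨r, by simp⟩
  · rintro ⟨r, rfl⟩
    exact ⟨r.computedByProbAutomaton, r.isStochasticLanguage, r.semantics_nil⟩
  · rintro ⟨h, hf⟩
    refine (h.eq_dirac_or_exists hf.2).imp_right ?_
    rintro ⟨c, hc, r, rfl⟩
    exact ⟨c, hc, r, fun w => rfl⟩
  · rintro (rfl | ⟨c, ⟨hc0, hc1⟩, r, h⟩)
    · exact ⟨computed_diracLang_nil, nonneg_dirac, hasSum_diracLang []⟩
    · obtain rfl : f = c • diracLang [] + (1 - c) • r.semantics := funext h
      refine ⟨computed_diracLang_nil.convex r.computedByProbAutomaton hc0 hc1.le, fun w => ?_, ?_⟩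
      · exact add_nonneg (mul_nonneg hc0 (nonneg_dirac w))
          (mul_nonneg (by linarith) (r.isStochasticLanguage.1 w))
      · have h1 := ((hasSum_diracLang []).const_smul c).add
          (r.isStochasticLanguage.2.const_smul (1 - c))
        rw [smul_eq_mul, smul_eq_mul, mul_one, mul_one, add_sub_cancel] at h1
        exact h1
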